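/- Let $\alpha\in(0,2)$, $\mathsf a>1$, $\mathfrak b\in(0,1/2)$, $C_u>0$ and $K>0$ be constants. Then there is a constant $C>0$, depending only on $\alpha,\mathsf a,\mathfrak b,C_u,K$, such that the following holds for all constants $C_\ell,T_0>0$. For each $n\in\mathbb N$ put $N=\lceil \mathsf a n\rceil$ and let $X=X_n=(x_{ij})$ be an $N\times n$ random matrix with i.i.d. real entries satisfying $$C_\ell\,t^{-\alpha}\le \mathbb P\{|x_{11}|>t\}\le C_u\,t^{-\alpha}\qquad\text{for all } t\ge T_0,$$ where $C_\ell$, $C_u$, $T_0$ do not depend on $n$. Let $s_1(X)\ge s_2(X)\ge\dots\ge s_n(X)$ denote the singular values of $X$ (the square roots of the eigenvalues of $X^{\mathsf T}X$, counted with multiplicity), so that $s_n(X)=s_{\min}(X)$. Let $k=k_n\ge 0$ be integers with $k=O(n^{1-2\mathfrak b})$ as $n\to\infty$ (so $k<n$ for all large $n$). Then $$\mathbb P\Big\{s_{n-k}(X)\ge C\,N^{1/\alpha}(\log N)^{\frac{\alpha-2}{2\alpha}}\Big\}=O(N^{-K})\qquad (n\to\infty).$$ -/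

import Mathlib

open MeasureTheory ProbabilityTheory Filter Asymptotics

/-- `X` is an `N × n` random matrix on the probability space `(Ω, P)` with i.i.d. real entries whose
common law has a two-sided power tail of exponent `α`:
`Cl * t ^ (-α) ≤ P (|x_ij| > t) ≤ Cu * t ^ (-α)` for all `t ≥ T₀`. -/
structure IsHeavyTailedMatrix {Ω : Type*} [MeasurableSpace Ω] (P : Measure Ω) {N n : ℕ}
    (X : Ω → Matrix (Fin N) (Fin n) ℝ) (α Cl Cu T₀ : ℝ) : Prop where
  measurable_entry : ∀ i j, Measurable fun ω => X ω i j
  indep : iIndepFun (fun (p : Fin N × Fin n) (ω : Ω) => X ω p.1 p.2) P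
  identDistrib : ∀ p q : Fin N × Fin n,
    IdentDistrib (fun ω => X ω p.1 p.2) (fun ω => X ω q.1 q.2) P P
  tail_lower : ∀ i j, ∀ t : ℝ, T₀ ≤ t → Cl * t ^ (-α) ≤ P.real {ω | t < |X ω i j|}
  tail_upper : ∀ i j, ∀ t : ℝ, T₀ ≤ t → P.real {ω | t < |X ω i j|} ≤ Cu * t ^ (-α)

/-- The `j`-th largest singular value `s_j(A)`, `1 ≤ j ≤ n`, of a real `N × n` matrix `A`, counted
with multiplicity: `s_1(A) ≥ s_2(A) ≥ ⋯ ≥ s_n(A)`. (Mathlib's decreasing enumeration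
starts at the index `0`.) -/
noncomputable def matrixSingularValue {N n : ℕ} (A : Matrix (Fin N) (Fin n) ℝ) (j : ℕ) : ℝ :=
  (Matrix.toEuclideanLin A).singularValues (j - 1)

/-! A heavy-tailed column is occasionally short. Choose `τ` with `Cu * τ ^ (-α) = (b / 2) * log N /
N`. All `N` entries of a column stay below `τ` with probability at least `N ^ (-b)`, and on that
event a truncated second moment and Markov bound the squared norm by `R`, of order `N * τ ^ (2 -
α)`, at the cost of a factor `1 / 2` (`half_pow_le_measureReal_sum_sq_le`).

Columns are independent, so the number of short ones is of order at least `n ^ (1 - b)`, which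
dominates `k = O(n ^ (1 - 2 * b))`; Chernoff makes the failure probability smaller than any power of
`N` (`measureReal_card_le_le_exp`). More than `2 * k` short columns force the squared singular value
to be at most `2 * R`, by averaging (`card_sub_mul_sq_matrixSingularValue_le`). Inserting `τ` gives
`R` of order `N ^ (2 / α) * (log N) ^ ((α - 2) / α)`. -/

/-! ### Short columns and small singular values. -/

/-- Expand each `e j` in eigenvectors of `AᵀA`. Only the `k` eigenvectors after `l₀` may have
eigenvalue below `lam l₀`, and being unit vectors they absorb total mass at most `k` from all the `e
j`. -/
theorem card_sub_mul_sq_matrixSingularValue_le {N n : ℕ} (A : Matrix (Fin N) (Fin n) ℝ)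
    (J : Finset (Fin n)) {k : ℕ} (hk : k < n) :
    ((J.card : ℝ) - k) * matrixSingularValue A (n - k) ^ 2 ≤ ∑ j ∈ J, ∑ i, A i j ^ 2 := by
  set T := Matrix.toEuclideanLin A with hTdef
  have hn : Module.finrank ℝ (EuclideanSpace ℝ (Fin n)) = n := by simp
  have hS := T.isSymmetric_adjoint_comp_self
  set v := hS.eigenvectorBasis hn with hv
  set lam := hS.eigenvalues hn with hlam
  -- Eigenvalues are indexed from `0`, so exactly `k` indices exceed `l₀`.
  set l₀ : Fin n := ⟨n - k - 1, by omega⟩ with hl₀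
  have hs : matrixSingularValue A (n - k) ^ 2 = lam l₀ :=
    T.sq_singularValues_of_lt hn (i := n - k - 1) (by omega)
  have hlam0 : ∀ l, 0 ≤ lam l := T.isPositive_adjoint_comp_self.nonneg_eigenvalues hn
  let e : Fin n → EuclideanSpace ℝ (Fin n) := fun j => EuclideanSpace.single j 1
  let c : Fin n → Fin n → ℝ := fun j l => v.repr (e j) l
  have hcol : ∀ j, ∑ i, A i j ^ 2 = ∑ l, lam l * c j l ^ 2 := by
    intro j
    have h1 : ‖T (e j)‖ ^ 2 = ∑ i, A i j ^ 2 := by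
      rw [EuclideanSpace.norm_sq_eq]
      refine Finset.sum_congr rfl fun i _ => ?_
      rw [Real.norm_eq_abs, sq_abs]
      simp [hTdef, e, Matrix.toLpLin_apply]
    have h2 : ‖T (e j)‖ ^ 2 = inner ℝ (e j) ((LinearMap.adjoint T ∘ₗ T) (e j)) := by
      rw [LinearMap.comp_apply, LinearMap.adjoint_inner_right, real_inner_self_eq_norm_sq]
    rw [← h1, h2, ← v.repr.inner_map_map, PiLp.inner_apply]
    refine Finset.sum_congr rfl fun l _ => ?_
    rw [hv, hS.eigenvectorBasis_apply_self_apply hn (e j) l]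
    simp only [c, hv, hlam, RCLike.inner_apply, conj_trivial, RCLike.ofReal_real_eq_id, id]
    ring
  have hrow : ∀ j, ∑ l, c j l ^ 2 = 1 := by
    intro j
    have : ‖v.repr (e j)‖ ^ 2 = 1 := by simp [e]
    rw [EuclideanSpace.norm_sq_eq] at this
    simpa [c] using this
  have hunit : ∀ l, ∑ j, c j l ^ 2 = 1 := by
    intro l
    have : ‖v l‖ ^ 2 = 1 := by simp
    rw [EuclideanSpace.norm_sq_eq] at this
    rw [← this]
    refine Finset.sum_congr rfl fun j _ => ?_
    rw [Real.norm_eq_abs, sq_abs]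
    simp only [c, e, OrthonormalBasis.repr_apply_apply]
    simp [EuclideanSpace.inner_single_right]
  have hlower : ∀ j, lam l₀ * (1 - ∑ l with l₀ < l, c j l ^ 2) ≤ ∑ i, A i j ^ 2 := by
    intro j
    have hsplit := Finset.sum_filter_add_sum_filter_not Finset.univ (fun l => l₀ < l)
      (fun l => c j l ^ 2)
    rw [hrow j] at hsplit
    rw [hcol j, ← hsplit, add_sub_cancel_left, Finset.mul_sum]
    calc _ ≤ ∑ l with ¬ l₀ < l, lam l * c j l ^ 2 := by
          refine Finset.sum_le_sum fun l hl => ?_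
          have : l ≤ l₀ := by simpa using hl
          exact mul_le_mul_of_nonneg_right (hS.eigenvalues_antitone hn this) (sq_nonneg _)
      _ ≤ _ := Finset.sum_le_sum_of_subset_of_nonneg (Finset.filter_subset _ _)
          fun l _ _ => mul_nonneg (hlam0 l) (sq_nonneg _)
  have hk' : ∑ j ∈ J, ∑ l with l₀ < l, c j l ^ 2 ≤ k := by
    rw [Finset.sum_comm]
    calc _ ≤ ∑ l with l₀ < l, (1 : ℝ) := by
          refine Finset.sum_le_sum fun l _ => ?_
          rw [← hunit l]
          exact Finset.sum_le_sum_of_subset_of_nonneg (Finset.subset_univ _)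
            fun _ _ _ => sq_nonneg _
      _ = k := by
          rw [Finset.sum_const, nsmul_eq_mul, mul_one, Finset.filter_lt_eq_Ioi, Fin.card_Ioi]
          simp only [hl₀]
          congr 1
          omega
  calc _ = lam l₀ * ((J.card : ℝ) - k) := by rw [hs, mul_comm]
    _ ≤ lam l₀ * ((J.card : ℝ) - ∑ j ∈ J, ∑ l with l₀ < l, c j l ^ 2) :=
        mul_le_mul_of_nonneg_left (by linarith) (hlam0 _)
    _ = ∑ j ∈ J, lam l₀ * (1 - ∑ l with l₀ < l, c j l ^ 2) := by
        rw [← Finset.mul_sum, Finset.sum_sub_distrib]; simp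
    _ ≤ _ := Finset.sum_le_sum fun j _ => hlower j

/-! ### Truncated second moment. -/

/-- Layer cake: integrate `2 * t` against the tail, bounding the tail by `1` up to `T₀`, by the
power law up to `τ`, and by `0` beyond. -/
theorem lintegral_sq_indicator_le_of_tail_le {Ω : Type*} [MeasurableSpace Ω] {P : Measure Ω}
    [IsProbabilityMeasure P] {x : Ω → ℝ} (hx : Measurable x) {α Cu T₀ τ : ℝ} (hα2 : α < 2)
    (hCu : 0 ≤ Cu) (hT₀ : 0 ≤ T₀) (hτ : 0 ≤ τ)
    (htail : ∀ t : ℝ, T₀ ≤ t → P.real {ω | t < |x ω|} ≤ Cu * t ^ (-α)) :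
    ∫⁻ ω, ENNReal.ofReal ({ω | |x ω| ≤ τ}.indicator (fun ω => x ω ^ 2) ω) ∂P ≤
      ENNReal.ofReal (T₀ ^ 2 + 2 * Cu / (2 - α) * τ ^ (2 - α)) := by
  have hms : MeasurableSet {ω | |x ω| ≤ τ} := measurableSet_le hx.abs measurable_const
  set f : Ω → ℝ := {ω | |x ω| ≤ τ}.indicator (fun ω => |x ω|) with hf
  have hf0 : 0 ≤ f := fun ω => Set.indicator_nonneg (fun _ _ => abs_nonneg _) ω
  have hfm : Measurable f := hx.abs.indicator hms
  have hsq : ∀ ω, ENNReal.ofReal ({ω | |x ω| ≤ τ}.indicator (fun ω => x ω ^ 2) ω) =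
      ENNReal.ofReal (∫ t in (0 : ℝ)..f ω, 2 * t) := by
    intro ω
    congr 1
    rw [intervalIntegral.integral_const_mul, integral_id]
    by_cases h : ω ∈ {ω | |x ω| ≤ τ}
    · simp only [hf, Set.indicator_of_mem h, sq_abs]; ring
    · simp only [hf, Set.indicator_of_notMem h]; ring
  simp_rw [hsq]
  rw [lintegral_comp_eq_lintegral_meas_lt_mul P (Eventually.of_forall hf0) hfm.aemeasurable
    (fun t _ => (by fun_prop : Continuous fun t : ℝ => 2 * t).intervalIntegrable _ _)
    ((ae_restrict_iff' measurableSet_Ioi).2 (Eventually.of_forall fun t ht => by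
      have : (0 : ℝ) < t := ht
      positivity))]
  have hpt : ∀ t ∈ Set.Ioi (0 : ℝ), P {ω | t < f ω} * ENNReal.ofReal (2 * t) ≤
      (Set.Ioc 0 T₀).indicator (fun t => ENNReal.ofReal (2 * t)) t +
      (Set.Ioc 0 τ).indicator (fun t => ENNReal.ofReal (2 * Cu * t ^ (1 - α))) t := by
    intro t ht
    have ht : (0 : ℝ) < t := ht
    rcases le_or_gt t T₀ with h1 | h1
    · rw [Set.indicator_of_mem (show t ∈ Set.Ioc 0 T₀ from ⟨ht, h1⟩)]
      refine le_add_right ?_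
      exact mul_le_of_le_one_left' prob_le_one
    refine le_add_left ?_
    rcases le_or_gt t τ with h2 | h2
    · rw [Set.indicator_of_mem (show t ∈ Set.Ioc 0 τ from ⟨ht, h2⟩)]
      have h3 : P {ω | t < f ω} ≤ ENNReal.ofReal (Cu * t ^ (-α)) := by
        calc P {ω | t < f ω} ≤ P {ω | t < |x ω|} := by
              refine measure_mono fun ω (hω : t < f ω) => ?_
              exact hω.trans_le (Set.indicator_le_self' (fun _ _ => abs_nonneg _) ω)
          _ = ENNReal.ofReal (P.real {ω | t < |x ω|}) := by simp
          _ ≤ _ := ENNReal.ofReal_le_ofReal (htail t h1.le)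
      calc _ ≤ ENNReal.ofReal (Cu * t ^ (-α)) * ENNReal.ofReal (2 * t) := by gcongr
        _ = _ := by
          rw [← ENNReal.ofReal_mul (by positivity), show 1 - α = -α + 1 by ring,
            Real.rpow_add ht, Real.rpow_one]
          congr 1; ring
    · have : {ω | t < f ω} = ∅ := by
        refine Set.eq_empty_of_forall_notMem fun ω (hω : t < f ω) => ?_
        by_cases h : ω ∈ {ω | |x ω| ≤ τ}
        · rw [hf, Set.indicator_of_mem h] at hω
          have : |x ω| ≤ τ := h
          linarith
        · rw [hf, Set.indicator_of_notMem h] at hω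
          linarith
      simp [this]
  have hI1 : ∫⁻ t in Set.Ioc 0 T₀, ENNReal.ofReal (2 * t) = ENNReal.ofReal (T₀ ^ 2) := by
    rw [← ofReal_integral_eq_lintegral_ofReal]
    · rw [← intervalIntegral.integral_of_le hT₀, intervalIntegral.integral_const_mul, integral_id]
      congr 1; ring
    · exact (by fun_prop : Continuous fun t : ℝ => 2 * t).integrableOn_Ioc
    · exact (ae_restrict_iff' measurableSet_Ioc).2 (Eventually.of_forall fun t ht => by
        have : (0 : ℝ) < t := ht.1
        positivity)
  have hI2 : ∫⁻ t in Set.Ioc 0 τ, ENNReal.ofReal (2 * Cu * t ^ (1 - α)) =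
      ENNReal.ofReal (2 * Cu / (2 - α) * τ ^ (2 - α)) := by
    rw [← ofReal_integral_eq_lintegral_ofReal]
    · rw [← intervalIntegral.integral_of_le hτ, intervalIntegral.integral_const_mul,
        integral_rpow (Or.inl (by linarith)), show 1 - α + 1 = 2 - α by ring,
        Real.zero_rpow (by linarith)]
      congr 1; ring
    · exact ((intervalIntegral.intervalIntegrable_rpow' (by linarith)).1).const_mul _
    · exact (ae_restrict_iff' measurableSet_Ioc).2 (Eventually.of_forall fun t ht => by
        have : (0 : ℝ) < t := ht.1
        positivity)
  have hα : 0 < 2 - α := by linarith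
  calc _ ≤ ∫⁻ t in Set.Ioi (0 : ℝ), ((Set.Ioc 0 T₀).indicator (fun t => ENNReal.ofReal (2 * t)) t +
      (Set.Ioc 0 τ).indicator (fun t => ENNReal.ofReal (2 * Cu * t ^ (1 - α))) t) :=
        setLIntegral_mono' measurableSet_Ioi hpt
    _ ≤ ∫⁻ t, ((Set.Ioc 0 T₀).indicator (fun t => ENNReal.ofReal (2 * t)) t +
      (Set.Ioc 0 τ).indicator (fun t => ENNReal.ofReal (2 * Cu * t ^ (1 - α))) t) :=
        setLIntegral_le_lintegral _ _
    _ = _ := by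
      rw [lintegral_add_left ((by fun_prop : Measurable fun t : ℝ =>
          ENNReal.ofReal (2 * t)).indicator measurableSet_Ioc),
        lintegral_indicator measurableSet_Ioc, lintegral_indicator measurableSet_Ioc, hI1, hI2,
        ENNReal.ofReal_add (by positivity) (by positivity)]

theorem integral_sq_indicator_le_of_tail_le {Ω : Type*} [MeasurableSpace Ω] {P : Measure Ω}
    [IsProbabilityMeasure P] {x : Ω → ℝ} (hx : Measurable x) {α Cu T₀ τ : ℝ} (hα2 : α < 2)
    (hCu : 0 ≤ Cu) (hT₀ : 0 ≤ T₀) (hτ : 0 ≤ τ)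
    (htail : ∀ t : ℝ, T₀ ≤ t → P.real {ω | t < |x ω|} ≤ Cu * t ^ (-α)) :
    ∫ ω, {ω | |x ω| ≤ τ}.indicator (fun ω => x ω ^ 2) ω ∂P ≤
      T₀ ^ 2 + 2 * Cu / (2 - α) * τ ^ (2 - α) := by
  have hα : 0 < 2 - α := by linarith
  have hms : MeasurableSet {ω | |x ω| ≤ τ} := measurableSet_le hx.abs measurable_const
  rw [integral_eq_lintegral_of_nonneg_ae
    (Eventually.of_forall fun ω => Set.indicator_nonneg (fun _ _ => sq_nonneg _) ω)
    ((hx.pow_const 2).indicator hms).aestronglyMeasurable]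
  exact ENNReal.toReal_le_of_le_ofReal (by positivity)
    (lintegral_sq_indicator_le_of_tail_le hx hα2 hCu hT₀ hτ htail)

/-! ### Independence of columns and the probability that one is short. -/

theorem iIndepFun_columns {Ω ι κ : Type*} [MeasurableSpace Ω] {P : Measure Ω}
    {X : ι → κ → Ω → ℝ} (hm : ∀ i j, Measurable (X i j))
    (h : iIndepFun (fun (p : ι × κ) ω => X p.1 p.2 ω) P) :
    iIndepFun (fun (j : κ) ω (i : ι) => X i j ω) P := by
  have := h.isProbabilityMeasure
  have h' : iIndepFun (fun (p : κ × ι) ω => X p.2 p.1 ω) P :=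
    h.precomp (g := Prod.swap) Prod.swap_injective
  have hcol : ∀ j, iIndepFun (fun i => X i j) P := fun j =>
    h.precomp (g := fun i => (i, j)) fun _ _ hab => congrArg Prod.fst hab
  have : ∀ j i, IsProbabilityMeasure (P.map (X i j)) :=
    fun j i => Measure.isProbabilityMeasure_map (hm i j).aemeasurable
  have hmc : ∀ j, Measurable fun ω (i : ι) => X i j ω := fun j => by fun_prop
  rw [iIndepFun_iff_map_fun_eq_infinitePi_map hmc]
  have h1 := (iIndepFun_iff_map_fun_eq_infinitePi_map (by fun_prop)).1 h'
  have h2 : (fun ω j i => X i j ω) =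
      MeasurableEquiv.curry κ ι ℝ ∘ fun ω (p : κ × ι) => X p.2 p.1 ω := by
    ext; simp
  rw [h2, ← Measure.map_map (by fun_prop) (by fun_prop), h1,
    Measure.infinitePi_map_curry (fun j i => P.map (X i j))]
  congr 1
  funext j
  exact ((iIndepFun_iff_map_fun_eq_infinitePi_map (fun i => hm i j)).1 (hcol j)).symm

/-- Markov's inequality conditionally on no entry exceeding `τ`. The conditioning is done by
weighting with the product of the cutoffs `χ (x i)`, which factorizes by independence. -/
theorem half_pow_le_measureReal_sum_sq_le {Ω ι : Type*} [MeasurableSpace Ω] [Fintype ι]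
    {P : Measure Ω} [IsProbabilityMeasure P] {x : ι → Ω → ℝ} (hm : ∀ i, Measurable (x i))
    (hind : iIndepFun x P) {τ u m R : ℝ} (hu2 : u ≤ 1 / 2)
    (htail : ∀ i, P.real {ω | τ < |x i ω|} ≤ u)
    (hsq : ∀ i, ∫ ω, {ω | |x i ω| ≤ τ}.indicator (fun ω => x i ω ^ 2) ω ∂P ≤ m)
    (hR : 0 < R) (hmR : 4 * Fintype.card ι * m ≤ R) :
    (1 - u) ^ Fintype.card ι / 2 ≤ P.real {ω | ∑ i, x i ω ^ 2 ≤ R} := by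
  classical
  let χ : ℝ → ℝ := {y | |y| ≤ τ}.indicator 1
  have hms : MeasurableSet {y : ℝ | |y| ≤ τ} := measurableSet_le measurable_id.abs measurable_const
  have hχm : Measurable χ := measurable_one.indicator hms
  have hχ0 : ∀ y, 0 ≤ χ y := fun y => Set.indicator_nonneg (fun _ _ => zero_le_one) y
  have hχ1 : ∀ y, χ y ≤ 1 := fun y => Set.indicator_le_self' (fun _ _ => zero_le_one) y
  have hχsq : ∀ y, χ y * y ^ 2 ≤ τ ^ 2 := by
    intro y
    by_cases h : y ∈ {y : ℝ | |y| ≤ τ}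
    · simp only [χ, Set.indicator_of_mem h, Pi.one_apply, one_mul]
      exact sq_le_sq' (abs_le.1 h).1 (abs_le.1 h).2
    · simp only [χ, Set.indicator_of_notMem h, zero_mul]; positivity
  let q : ι → ℝ := fun i => ∫ ω, χ (x i ω) ∂P
  have hq : ∀ i, 1 - u ≤ q i := by
    intro i
    have h1 : q i = P.real {ω | |x i ω| ≤ τ} := by
      rw [← integral_indicator_one (measurableSet_le (hm i).abs measurable_const)]
      rfl
    have h2 := probReal_compl_eq_one_sub (μ := P)
      (measurableSet_lt (measurable_const (a := τ)) (hm i).abs)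
    have h3 : {ω | τ < |x i ω|}ᶜ = {ω | |x i ω| ≤ τ} := by ext; simp
    rw [h1, ← h3, h2]
    linarith [htail i]
  have hprod : ∫ ω, ∏ i, χ (x i ω) ∂P = ∏ i, q i :=
    hind.integral_fun_prod_comp (f := fun _ => χ) (fun i => (hm i).aemeasurable)
      fun i => hχm.aestronglyMeasurable
  have hprod0 : ∀ ω, 0 ≤ ∏ i, χ (x i ω) := fun ω => Finset.prod_nonneg fun i _ => hχ0 _
  have hprod1 : ∀ ω, ∏ i, χ (x i ω) ≤ 1 := fun ω => Finset.prod_le_one (fun i _ => hχ0 _)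
    fun i _ => hχ1 _
  have hqprod0 : 0 ≤ ∏ i, q i := Finset.prod_nonneg fun i _ => by linarith [hq i]
  -- The factor `2` restores the missing `q i`, which is at least `1 / 2`.
  have hsqi : ∀ i, ∫ ω, (∏ l, χ (x l ω)) * x i ω ^ 2 ∂P ≤ 2 * m * ∏ l, q l := by
    intro i
    let F : ι → ℝ → ℝ := fun l y => χ y * if l = i then y ^ 2 else 1
    have hF := hind.integral_fun_prod_comp (f := F) (fun i => (hm i).aemeasurable) fun l =>
      (hχm.mul (by split_ifs <;> fun_prop)).aestronglyMeasurable
    have h1 : ∀ ω, (∏ l, χ (x l ω)) * x i ω ^ 2 = ∏ l, F l (x l ω) := by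
      intro ω
      rw [Finset.prod_mul_distrib, Finset.prod_ite_eq', if_pos (Finset.mem_univ i)]
    simp_rw [h1]
    rw [hF]
    rw [← Finset.mul_prod_erase _ _ (Finset.mem_univ i),
      ← Finset.mul_prod_erase _ q (Finset.mem_univ i)]
    have h2 : ∏ l ∈ Finset.univ.erase i, ∫ ω, χ (x l ω) * (if l = i then x l ω ^ 2 else 1) ∂P
        = ∏ l ∈ Finset.univ.erase i, q l := by
      refine Finset.prod_congr rfl fun l hl => ?_
      simp [Finset.ne_of_mem_erase hl, q]
    have h3 : ∫ ω, χ (x i ω) * (if i = i then x i ω ^ 2 else 1) ∂P ≤ m := by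
      refine le_trans (le_of_eq ?_) (hsq i)
      congr 1
      funext ω
      by_cases h : |x i ω| ≤ τ <;> simp [χ, Set.indicator, h]
    have h30 : 0 ≤ ∫ ω, χ (x i ω) * (if i = i then x i ω ^ 2 else 1) ∂P :=
      integral_nonneg fun ω => mul_nonneg (hχ0 _) (by split_ifs <;> positivity)
    rw [h2, ← mul_assoc]
    refine mul_le_mul_of_nonneg_right ?_ (Finset.prod_nonneg fun l _ => by linarith [hq l])
    nlinarith [hq i]
  have hint1 : Integrable (fun ω => ∏ i, χ (x i ω)) P := by
    refine Integrable.of_bound (C := 1) ?_ (Eventually.of_forall fun ω => ?_)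
    · exact (Finset.measurable_fun_prod _ fun i _ => hχm.comp (hm i)).aestronglyMeasurable
    · rw [Real.norm_eq_abs, abs_of_nonneg (hprod0 ω)]; exact hprod1 ω
  have hint2 : ∀ i, Integrable (fun ω => (∏ l, χ (x l ω)) * x i ω ^ 2) P := by
    intro i
    refine Integrable.of_bound (C := τ ^ 2) ?_ (Eventually.of_forall fun ω => ?_)
    · exact ((Finset.measurable_fun_prod _ fun i _ => hχm.comp (hm i)).mul
        ((hm i).pow_const 2)).aestronglyMeasurable
    · rw [Real.norm_eq_abs, abs_of_nonneg (mul_nonneg (hprod0 ω) (sq_nonneg _))]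
      refine le_trans (mul_le_mul_of_nonneg_right ?_ (sq_nonneg _)) (hχsq (x i ω))
      rw [← Finset.mul_prod_erase _ _ (Finset.mem_univ i)]
      exact mul_le_of_le_one_right (hχ0 _)
        (Finset.prod_le_one (fun i _ => hχ0 _) fun i _ => hχ1 _)
  have hmG : MeasurableSet {ω | ∑ i, x i ω ^ 2 ≤ R} :=
    measurableSet_le (Finset.measurable_fun_sum _ fun i _ => (hm i).pow_const 2) measurable_const
  have hpt : ∀ ω, ∏ i, χ (x i ω) ≤ {ω | ∑ i, x i ω ^ 2 ≤ R}.indicator 1 ω +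
      (∑ i, (∏ l, χ (x l ω)) * x i ω ^ 2) / R := by
    intro ω
    by_cases h : ω ∈ {ω | ∑ i, x i ω ^ 2 ≤ R}
    · rw [Set.indicator_of_mem h]
      have : 0 ≤ (∑ i, (∏ l, χ (x l ω)) * x i ω ^ 2) / R :=
        div_nonneg (Finset.sum_nonneg fun i _ => mul_nonneg (hprod0 ω) (sq_nonneg _)) hR.le
      have := hprod1 ω
      simp only [Pi.one_apply]
      linarith
    · rw [Set.indicator_of_notMem h, zero_add, le_div_iff₀ hR, ← Finset.mul_sum]
      have : R < ∑ i, x i ω ^ 2 := by simpa using h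
      exact mul_le_mul_of_nonneg_left this.le (hprod0 ω)
  have hmain : ∏ i, q i ≤ P.real {ω | ∑ i, x i ω ^ 2 ≤ R} +
      (Fintype.card ι * (2 * m * ∏ l, q l)) / R := by
    have hi1 : Integrable ({ω | ∑ i, x i ω ^ 2 ≤ R}.indicator (1 : Ω → ℝ)) P :=
      (integrable_const (1 : ℝ)).indicator hmG
    have hi2 : Integrable (fun ω => (∑ i, (∏ l, χ (x l ω)) * x i ω ^ 2) / R) P :=
      (integrable_finsetSum _ fun i _ => hint2 i).div_const R
    calc ∏ i, q i = ∫ ω, ∏ i, χ (x i ω) ∂P := hprod.symm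
      _ ≤ ∫ ω, ({ω | ∑ i, x i ω ^ 2 ≤ R}.indicator 1 ω +
          (∑ i, (∏ l, χ (x l ω)) * x i ω ^ 2) / R) ∂P :=
        integral_mono hint1 (hi1.add hi2) hpt
      _ = P.real {ω | ∑ i, x i ω ^ 2 ≤ R} +
          (∑ i, ∫ ω, (∏ l, χ (x l ω)) * x i ω ^ 2 ∂P) / R := by
        rw [integral_add hi1 hi2, integral_indicator_one hmG, integral_div,
          integral_finsetSum _ fun i _ => hint2 i]
      _ ≤ _ := by
        gcongr
        refine (Finset.sum_le_sum fun i _ => hsqi i).trans ?_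
        simp
  have h4 : (Fintype.card ι * (2 * m * ∏ l, q l)) / R ≤ (∏ l, q l) / 2 := by
    rw [div_le_div_iff₀ hR two_pos]
    nlinarith
  have h5 : (1 - u) ^ Fintype.card ι ≤ ∏ i, q i := by
    rw [← Finset.card_univ, ← Finset.prod_const]
    exact Finset.prod_le_prod (fun i _ => by linarith) fun i _ => hq i
  linarith

/-! ### Number of short columns. -/

/-- Chernoff bound with parameter `-1`: each indicator has mgf at most `1 - p / 2`, since `1 - exp
(-1) ≥ 1 / 2`. -/
theorem measureReal_card_le_le_exp {Ω ι : Type*} [MeasurableSpace Ω] [Fintype ι]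
    {P : Measure Ω} {β : Type*} [MeasurableSpace β] {Y : ι → Ω → β} (hm : ∀ i, Measurable (Y i))
    (hind : iIndepFun Y P) {G : Set β} (hG : MeasurableSet G) {p : ℝ}
    (hp : ∀ i, p ≤ P.real (Y i ⁻¹' G)) (r : ℕ) :
    P.real {ω | {i | Y i ω ∈ G}.ncard ≤ r} ≤ Real.exp (r - Fintype.card ι * p / 2) := by
  classical
  have := hind.isProbabilityMeasure
  let φ : β → ℝ := G.indicator 1
  have hφ : Measurable φ := measurable_one.indicator hG
  let Z : ι → Ω → ℝ := fun i ω => φ (Y i ω)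
  have hZm : ∀ i, Measurable (Z i) := fun i => hφ.comp (hm i)
  have hZ : iIndepFun Z P := hind.comp (fun _ => φ) fun _ => hφ
  have hcard : ∀ ω, (∑ i, Z i) ω = ({i | Y i ω ∈ G}.ncard : ℝ) := by
    intro ω
    rw [Finset.sum_apply, Set.ncard_eq_toFinset_card']
    simp [Z, φ, Set.indicator_apply]
  have hint : Integrable (fun ω => Real.exp (-1 * (∑ i, Z i) ω)) P := by
    refine Integrable.of_bound (C := 1) ?_ (Eventually.of_forall fun ω => ?_)
    · have : Measurable (∑ i, Z i) := by fun_prop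
      exact (this.const_mul (-1)).exp.aestronglyMeasurable
    · rw [Real.norm_eq_abs, abs_of_pos (Real.exp_pos _), hcard ω, Real.exp_le_one_iff]
      have : (0 : ℝ) ≤ ({i | Y i ω ∈ G}.ncard : ℝ) := Nat.cast_nonneg _
      linarith
  have hmgf : ∀ i, mgf (Z i) P (-1) ≤ Real.exp (-(p / 2)) := by
    intro i
    have hpre := hm i hG
    have h1 : ∀ ω, Real.exp (-1 * Z i ω) =
        1 - (1 - Real.exp (-1)) * (Y i ⁻¹' G).indicator 1 ω := by
      intro ω
      by_cases h : Y i ω ∈ G <;> simp [Z, φ, h]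
    have h2 : mgf (Z i) P (-1) = 1 - (1 - Real.exp (-1)) * P.real (Y i ⁻¹' G) := by
      rw [mgf]
      simp_rw [h1]
      have hi : Integrable ((Y i ⁻¹' G).indicator (1 : Ω → ℝ)) P :=
        (integrable_const (1 : ℝ)).indicator hpre
      rw [integral_sub (integrable_const _) (hi.const_mul _),
        integral_const_mul, integral_indicator_one hpre]
      simp
    have h3 : Real.exp (-1) ≤ 1 / 2 := by
      rw [Real.exp_neg, ← one_div]
      exact one_div_le_one_div_of_le two_pos (by linarith [Real.add_one_le_exp (1 : ℝ)])
    have h4 : 0 ≤ P.real (Y i ⁻¹' G) := measureReal_nonneg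
    rw [h2]
    have := Real.add_one_le_exp (-(p / 2))
    nlinarith [hp i]
  calc P.real {ω | {i | Y i ω ∈ G}.ncard ≤ r} = P.real {ω | (∑ i, Z i) ω ≤ r} := by
        congr 1; ext ω; simp only [Set.mem_ofPred_eq, hcard ω, Nat.cast_le]
    _ ≤ Real.exp (- -1 * r) * mgf (∑ i, Z i) P (-1) :=
        measure_le_le_exp_mul_mgf _ (by norm_num) hint
    _ ≤ Real.exp (- -1 * r) * ∏ _i : ι, Real.exp (-(p / 2)) := by
        rw [hZ.mgf_sum hZm]
        refine mul_le_mul_of_nonneg_left ?_ (Real.exp_pos _).le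
        exact Finset.prod_le_prod (fun i _ => mgf_nonneg) fun i _ => hmgf i
    _ = _ := by
        rw [Finset.prod_const, ← Real.exp_nat_mul, ← Real.exp_add, Finset.card_univ]
        congr 1; ring

/-! ### Non-asymptotic singular value bound. -/

theorem IsHeavyTailedMatrix.measureReal_sq_singularValue_le {Ω : Type*} [MeasurableSpace Ω]
    {P : Measure Ω} [IsProbabilityMeasure P] {N n : ℕ} {X : Ω → Matrix (Fin N) (Fin n) ℝ}
    {α Cl Cu T₀ : ℝ} (hX : IsHeavyTailedMatrix P X α Cl Cu T₀) (hα2 : α < 2) (hCu : 0 ≤ Cu)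
    (hT₀ : 0 ≤ T₀) {τ m R : ℝ} (hτ : T₀ ≤ τ) (hu : Cu * τ ^ (-α) ≤ 1 / 2)
    (hm : T₀ ^ 2 + 2 * Cu / (2 - α) * τ ^ (2 - α) ≤ m) (hR : 0 < R) (hmR : 4 * N * m ≤ R)
    {k : ℕ} (hk : k < n) :
    P.real {ω | 2 * R < matrixSingularValue (X ω) (n - k) ^ 2} ≤
      Real.exp (2 * k - n * (1 - Cu * τ ^ (-α)) ^ N / 4) := by
  let Y : Fin n → Ω → Fin N → ℝ := fun j ω i => X ω i j
  let G : Set (Fin N → ℝ) := {y | ∑ i, y i ^ 2 ≤ R}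
  have hG : MeasurableSet G := measurableSet_le (by fun_prop) measurable_const
  have hY : ∀ j, Measurable (Y j) := fun j => measurable_pi_lambda _ fun i => hX.measurable_entry i j
  have hind : iIndepFun Y P :=
    iIndepFun_columns (X := fun i j ω => X ω i j) hX.measurable_entry hX.indep
  have hp : ∀ j, (1 - Cu * τ ^ (-α)) ^ N / 2 ≤ P.real (Y j ⁻¹' G) := by
    intro j
    have hcol : iIndepFun (fun (i : Fin N) ω => X ω i j) P :=
      hX.indep.precomp (g := fun i => (i, j)) fun _ _ hab => congrArg Prod.fst hab
    have := half_pow_le_measureReal_sum_sq_le (fun i => hX.measurable_entry i j) hcol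
      hu (fun i => hX.tail_upper i j τ hτ)
      (fun i => (integral_sq_indicator_le_of_tail_le (hX.measurable_entry i j) hα2 hCu hT₀
        (hT₀.trans hτ) (hX.tail_upper i j)).trans hm) hR (by simpa using hmR)
    rw [Fintype.card_fin] at this
    exact this
  have hmain := measureReal_card_le_le_exp hY hind hG hp (2 * k)
  rw [Fintype.card_fin] at hmain
  refine le_trans (measureReal_mono fun ω hω => ?_) (hmain.trans_eq ?_)
  · by_contra hcon
    have hω : 2 * R < matrixSingularValue (X ω) (n - k) ^ 2 := hω
    have hcon : 2 * k < {j | Y j ω ∈ G}.ncard := not_le.1 hcon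
    classical
    rw [Set.ncard_eq_toFinset_card'] at hcon
    set J := {j | Y j ω ∈ G}.toFinset with hJ
    -- More than `2 * k` short columns give `|J| ≤ 2 * (|J| - k)`, so averaging over `J` loses only
    -- a factor `2`.
    have h1 := card_sub_mul_sq_matrixSingularValue_le (X ω) J hk
    have h2 : ∑ j ∈ J, ∑ i, X ω i j ^ 2 ≤ J.card * R := by
      rw [← nsmul_eq_mul]
      refine Finset.sum_le_card_nsmul _ _ _ fun j hj => ?_
      have : Y j ω ∈ G := by simpa [hJ] using hj
      exact this
    have h3 : (2 * k : ℝ) < J.card := by exact_mod_cast hcon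
    have h4 : (0 : ℝ) ≤ k := Nat.cast_nonneg _
    nlinarith
  · congr 1; push_cast; ring

/-! ### Asymptotic estimates. -/

theorem exp_neg_two_mul_le_one_sub {u : ℝ} (h0 : 0 ≤ u) (h2 : u ≤ 1 / 2) :
    Real.exp (-(2 * u)) ≤ 1 - u := by
  rw [Real.exp_neg]
  calc (Real.exp (2 * u))⁻¹ ≤ (2 * u + 1)⁻¹ := by
        gcongr
        exact Real.add_one_le_exp _
    _ ≤ 1 - u := by
        rw [inv_le_iff_one_le_mul₀ (by linarith)]
        nlinarith

theorem rpow_neg_le_one_sub_pow {N : ℕ} {b : ℝ} (hN : 0 < N) (hb : 0 ≤ b)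
    (h : b / 2 * Real.log N / N ≤ 1 / 2) :
    (N : ℝ) ^ (-b) ≤ (1 - b / 2 * Real.log N / N) ^ N := by
  have hN' : (0 : ℝ) < N := by exact_mod_cast hN
  have hlog : 0 ≤ Real.log N := Real.log_natCast_nonneg N
  calc (N : ℝ) ^ (-b) = Real.exp (-(2 * (b / 2 * Real.log N / N))) ^ N := by
        rw [← Real.exp_nat_mul, Real.rpow_def_of_pos hN']
        congr 1
        field_simp
    _ ≤ _ := pow_le_pow_left₀ (Real.exp_pos _).le
        (exp_neg_two_mul_le_one_sub (by positivity) h) N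

theorem isLittleO_rpow_rpow_atTop {p q : ℝ} (h : p < q) :
    (fun x : ℝ => x ^ p) =o[atTop] fun x : ℝ => x ^ q := by
  refine (isLittleO_iff_tendsto' ?_).2 ?_
  · filter_upwards [eventually_gt_atTop 0] with x hx h0
    exact absurd h0 (Real.rpow_pos_of_pos hx q).ne'
  · refine (tendsto_rpow_neg_atTop (sub_pos.2 h)).congr' ?_
    filter_upwards [eventually_gt_atTop 0] with x hx
    rw [← Real.rpow_sub hx, neg_sub]

/-- Since `N ≤ (a + 1) * n`, the negative term has order at least `n ^ (1 - b)`, whereas `2 * k n`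
and `K * log N` are both `o(n ^ (1 - b))`. -/
theorem eventually_exp_le_rpow_neg {a b : ℝ} (ha : 1 < a) (hb : 0 < b) (hb2 : b < 1 / 2) (K : ℝ)
    (hK : 0 < K) {k : ℕ → ℕ}
    (hk : (fun n : ℕ => (k n : ℝ)) =O[atTop] fun n : ℕ => (n : ℝ) ^ (1 - 2 * b)) :
    ∀ᶠ n : ℕ in atTop,
      Real.exp (2 * k n - n * (⌈a * (n : ℝ)⌉₊ : ℝ) ^ (-b) / 4) ≤ (⌈a * (n : ℝ)⌉₊ : ℝ) ^ (-K) := by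
  have hlit : (fun n : ℕ => 2 * (k n : ℝ) + K * (Real.log (a + 1) + Real.log n)) =o[atTop]
      fun n : ℕ => (n : ℝ) ^ (1 - b) := by
    have h1 : (fun n : ℕ => (n : ℝ) ^ (1 - 2 * b)) =o[atTop] fun n : ℕ => (n : ℝ) ^ (1 - b) :=
      (isLittleO_rpow_rpow_atTop (by linarith)).comp_tendsto tendsto_natCast_atTop_atTop
    have h2 : (fun n : ℕ => Real.log n) =o[atTop] fun n : ℕ => (n : ℝ) ^ (1 - b) :=
      (isLittleO_log_rpow_atTop (by linarith)).comp_tendsto tendsto_natCast_atTop_atTop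
    have h3 : (fun _ : ℕ => Real.log (a + 1)) =o[atTop] fun n : ℕ => (n : ℝ) ^ (1 - b) := by
      refine isLittleO_const_left.2 (Or.inr ?_)
      exact tendsto_norm_atTop_atTop.comp
        ((tendsto_rpow_atTop (by linarith)).comp tendsto_natCast_atTop_atTop)
    exact ((hk.trans_isLittleO h1).const_mul_left 2).add ((h3.add h2).const_mul_left K)
  have hc : 0 < (a + 1) ^ (-b) / 4 := by positivity
  filter_upwards [hlit.def hc, eventually_ge_atTop 1] with n hn hn1
  have hn0 : (1 : ℝ) ≤ n := by exact_mod_cast hn1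
  have hN1 : (1 : ℝ) ≤ ⌈a * (n : ℝ)⌉₊ := by
    have := Nat.le_ceil (a * (n : ℝ)); nlinarith
  have hN2 : (⌈a * (n : ℝ)⌉₊ : ℝ) ≤ (a + 1) * n := by
    have := Nat.ceil_lt_add_one (show 0 ≤ a * (n : ℝ) by positivity); nlinarith
  set M : ℝ := (⌈a * (n : ℝ)⌉₊ : ℝ)
  rw [Real.norm_eq_abs, Real.norm_eq_abs, abs_of_nonneg (by positivity : (0 : ℝ) ≤ (n : ℝ) ^ (1 - b))]
    at hn
  have h1 := (le_abs_self _).trans hn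
  have h2 : Real.log M ≤ Real.log (a + 1) + Real.log n := by
    rw [← Real.log_mul (by positivity) (by positivity)]
    exact Real.log_le_log (by linarith) hN2
  have h3 : (a + 1) ^ (-b) * (n : ℝ) ^ (1 - b) ≤ n * M ^ (-b) := by
    calc (a + 1) ^ (-b) * (n : ℝ) ^ (1 - b) = n * ((a + 1) * n) ^ (-b) := by
          rw [Real.mul_rpow (by positivity) (by positivity), show 1 - b = 1 + -b by ring,
            Real.rpow_add (by positivity), Real.rpow_one]
          ring
      _ ≤ _ := mul_le_mul_of_nonneg_left
          (Real.rpow_le_rpow_of_nonpos (by linarith) hN2 (by linarith)) (by positivity)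
  rw [Real.rpow_def_of_pos (show 0 < M by linarith) (-K)]
  refine Real.exp_le_exp.2 ?_
  have h4 := mul_le_mul_of_nonneg_left h2 hK.le
  linarith

/-! ### Choice of constants and conclusion. -/

theorem mainTheorem6 (α a b Cu K : ℝ) (hα : 0 < α) (hα2 : α < 2) (ha : 1 < a)
    (hb : 0 < b) (hb2 : b < 1 / 2) (hCu : 0 < Cu) (hK : 0 < K) :
    ∃ C : ℝ, 0 < C ∧
      ∀ (Cl T₀ : ℝ), 0 < Cl → 0 < T₀ →
      ∀ (Ω : ℕ → Type*) [∀ n, MeasurableSpace (Ω n)] (P : ∀ n, Measure (Ω n))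
        [∀ n, IsProbabilityMeasure (P n)]
        (X : ∀ n : ℕ, Ω n → Matrix (Fin ⌈a * (n : ℝ)⌉₊) (Fin n) ℝ),
        (∀ n, IsHeavyTailedMatrix (P n) (X n) α Cl Cu T₀) →
      ∀ k : ℕ → ℕ,
        ((fun n : ℕ => (k n : ℝ)) =O[atTop] fun n : ℕ => (n : ℝ) ^ (1 - 2 * b)) →
        (fun n : ℕ => (P n).real {ω |
            C * (⌈a * (n : ℝ)⌉₊ : ℝ) ^ (1 / α)
                * Real.log (⌈a * (n : ℝ)⌉₊ : ℝ) ^ ((α - 2) / (2 * α))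
              ≤ matrixSingularValue (X n ω) (n - k n)})
          =O[atTop] fun n : ℕ => (⌈a * (n : ℝ)⌉₊ : ℝ) ^ (-K) := by
  have hα2' : 0 < 2 - α := by linarith
  -- The summand `1` absorbs `T₀ ^ 2`, eventually at most `τ ^ (2 - α)`; this keeps the constant
  -- independent of `T₀`.
  set D : ℝ := 1 + 2 * Cu / (2 - α) with hD
  have hD0 : 0 < D := by positivity
  -- Makes `u = Cu * τ ^ (-α)` equal `(b / 2) * log N / N`; then `1 - u ≥ exp (-(2 * u))` yields `(1
  -- - u) ^ N ≥ N ^ (-b)`.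
  set δ : ℝ := b / (2 * Cu) with hδ
  have hδ0 : 0 < δ := by positivity
  set γ : ℝ := (2 - α) / α with hγ
  have hγ0 : 0 < γ := by positivity
  -- `2 * R` is `8 * D * N * τ ^ (2 - α)`; taking `9` gives the strict inequality needed later.
  refine ⟨√(9 * D * δ ^ (-γ)), by positivity, ?_⟩
  intro Cl T₀ hCl hT₀ Ω _ P _ X hX k hk
  have hNt : Tendsto (fun n : ℕ => ⌈a * (n : ℝ)⌉₊) atTop atTop :=
    tendsto_nat_ceil_atTop.comp (tendsto_natCast_atTop_atTop.const_mul_atTop (by linarith))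
  have hlogN : Tendsto (fun x : ℝ => Real.log x / x) atTop (nhds 0) := by
    simpa using Real.isLittleO_log_id_atTop.tendsto_div_nhds_zero
  have hdiv : Tendsto (fun x : ℝ => x / (δ * Real.log x)) atTop atTop := by
    have h1 : Tendsto (fun x : ℝ => δ * (Real.log x / x)) atTop (nhdsWithin 0 (Set.Ioi 0)) := by
      refine tendsto_nhdsWithin_iff.2 ⟨by simpa using hlogN.const_mul δ, ?_⟩
      filter_upwards [eventually_gt_atTop 1] with x hx
      have := Real.log_pos hx
      have : 0 < x := by linarith
      exact Set.mem_Ioi.2 (by positivity)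
    refine h1.inv_tendsto_nhdsGT_zero.congr fun x => ?_
    rw [Pi.inv_apply, ← mul_div_assoc, inv_div]
  have hτt : Tendsto (fun x : ℝ => (x / (δ * Real.log x)) ^ (1 / α)) atTop atTop :=
    (tendsto_rpow_atTop (by positivity)).comp hdiv
  have hcast : Tendsto (fun n : ℕ => (⌈a * (n : ℝ)⌉₊ : ℝ)) atTop atTop :=
    tendsto_natCast_atTop_atTop.comp hNt
  have hkn : ∀ᶠ n : ℕ in atTop, k n < n := by
    have h1 : (fun n : ℕ => (n : ℝ) ^ (1 - 2 * b)) =o[atTop] fun n : ℕ => (n : ℝ) ^ (1 : ℝ) :=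
      (isLittleO_rpow_rpow_atTop (by linarith)).comp_tendsto tendsto_natCast_atTop_atTop
    filter_upwards [(hk.trans_isLittleO h1).def (by norm_num : (0 : ℝ) < 1 / 2),
      eventually_ge_atTop 1] with n hn hn1
    have : (1 : ℝ) ≤ n := by exact_mod_cast hn1
    rw [Real.rpow_one, Real.norm_natCast, Real.norm_natCast] at hn
    exact_mod_cast (show (k n : ℝ) < n by linarith)
  refine IsBigO.of_bound 1 ?_
  filter_upwards [eventually_exp_le_rpow_neg ha hb hb2 K hK hk, hkn,
    hcast.eventually_gt_atTop 1, (hτt.comp hcast).eventually_ge_atTop T₀,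
    (((tendsto_rpow_atTop hα2').comp hτt).comp hcast).eventually_ge_atTop (T₀ ^ 2),
    (hlogN.comp hcast).eventually_le_const (show 0 < 1 / b by positivity)]
    with n hexp hkn hN1 hτ hτ2 hlog
  simp only [Function.comp_apply] at hτ hτ2 hlog
  set N : ℕ := ⌈a * (n : ℝ)⌉₊ with hNdef
  have hN0 : (0 : ℝ) < N := by linarith
  have hL : 0 < Real.log N := Real.log_pos hN1
  set L : ℝ := Real.log N with hLdef
  set τ : ℝ := ((N : ℝ) / (δ * L)) ^ (1 / α) with hτdef
  have hτ0 : 0 < τ := by positivity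
  have hu : Cu * τ ^ (-α) = b / 2 * L / N := by
    rw [hτdef, ← Real.rpow_mul (by positivity), show 1 / α * -α = -1 by field_simp,
      Real.rpow_neg_one, hδ]
    field_simp
  have hu2 : b / 2 * L / N ≤ 1 / 2 := by
    have := mul_le_mul_of_nonneg_left hlog (by positivity : 0 ≤ b / 2)
    calc b / 2 * L / N = b / 2 * (L / N) := by ring
      _ ≤ b / 2 * (1 / b) := this
      _ = 1 / 2 := by field_simp
  have hm : T₀ ^ 2 + 2 * Cu / (2 - α) * τ ^ (2 - α) ≤ D * τ ^ (2 - α) := by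
    rw [hD, add_mul, one_mul]; linarith
  have hR0 : 0 < 4 * N * (D * τ ^ (2 - α)) := by positivity
  have hmain := (hX n).measureReal_sq_singularValue_le hα2 hCu.le hT₀.le hτ (hu.trans_le hu2) hm
    hR0 le_rfl hkn
  have hτγ : τ ^ (2 - α) = δ ^ (-γ) * ((N : ℝ) ^ γ * L ^ (-γ)) := by
    rw [hτdef, ← Real.rpow_mul (by positivity), show 1 / α * (2 - α) = γ by rw [hγ]; ring,
      Real.div_rpow hN0.le (by positivity), Real.mul_rpow hδ0.le hL.le,
      Real.rpow_neg hδ0.le, Real.rpow_neg hL.le]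
    field_simp
  have hbound : (√(9 * D * δ ^ (-γ)) * (N : ℝ) ^ (1 / α) * L ^ ((α - 2) / (2 * α))) ^ 2 =
      9 * D * N * τ ^ (2 - α) := by
    have e1 : ((N : ℝ) ^ (1 / α)) ^ 2 = N * (N : ℝ) ^ γ := by
      rw [← Real.rpow_natCast, ← Real.rpow_mul hN0.le,
        show 1 / α * ((2 : ℕ) : ℝ) = 1 + γ by rw [hγ]; push_cast; field_simp; ring,
        Real.rpow_add hN0, Real.rpow_one]
    have e2 : (L ^ ((α - 2) / (2 * α))) ^ 2 = L ^ (-γ) := by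
      rw [← Real.rpow_natCast, ← Real.rpow_mul hL.le]
      congr 1
      rw [hγ]; push_cast; field_simp; ring
    rw [mul_pow, mul_pow, e1, e2, Real.sq_sqrt (by positivity), hτγ]
    ring
  rw [Real.norm_of_nonneg measureReal_nonneg, Real.norm_of_nonneg (by positivity), one_mul]
  calc _ ≤ (P n).real {ω | 2 * (4 * N * (D * τ ^ (2 - α))) <
          matrixSingularValue (X n ω) (n - k n) ^ 2} := by
        refine measureReal_mono fun ω hω => ?_
        have h1 : √(9 * D * δ ^ (-γ)) * (N : ℝ) ^ (1 / α) * L ^ ((α - 2) / (2 * α)) ≤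
          matrixSingularValue (X n ω) (n - k n) := hω
        replace h1 := pow_le_pow_left₀ (by positivity) h1 2
        rw [hbound] at h1
        have : 0 < D * N * τ ^ (2 - α) := by positivity
        exact lt_of_lt_of_le (by linarith) h1
    _ ≤ _ := hmain
    _ ≤ Real.exp (2 * k n - n * (N : ℝ) ^ (-b) / 4) := by
        have := rpow_neg_le_one_sub_pow (by exact_mod_cast hN0) hb.le hu2
        rw [hu]
        gcongr
    _ ≤ _ := hexp
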